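/- Let $A$ be a $W^*$-algebra and $(E,A)$ a $W^*$-correspondence: a selfdual right Hilbert $C^*$-module $E$ over $A$ with a unital normal $*$-homomorphism $\varphi$ from $A$ to the algebra $\mathcal L(E)$ of adjointable operators. Let $\sigma:A\to B(H)$ be a unital normal $*$-representation, and let $E\otimes_\sigma H$ be the Hilbert space completion of $E\otimes H$ for $\langle x\otimes h,y\otimes k\rangle=\langle h,\sigma(\langle x,y\rangle)k\rangle$. Let $(E^\sigma)^*$ be the space of bounded operators $\eta^*:E\otimes_\sigma H\to H$ with $\eta^*(\varphi(a)\otimes I_H)=\sigma(a)\eta^*$ for all $a\in A$, let $E^\sigma$ be the space of their adjoints $\eta$, and let $\mathbb D((E^\sigma)^*)$ be the open unit ball of $(E^\sigma)^*$. The Hardy algebra $H^\infty(E)$ is the ultraweakly closed algebra generated by the operators $\varphi_\infty(a)$ ($a\in A$) and the creation operators $T_x$ ($x\in E$) on the Fock space of $E$. $\mathrm{Aut}(H^\infty(E))$ is the group of its completely isometric, $w^*$-homeomorphic automorphisms that fix every $\varphi_\infty(a)$. For $\eta^*\in\mathbb D((E^\sigma)^*)$ and $X\in H^\infty(E)$ put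 $\widehat X(\eta^*)=(\sigma\times\eta^*)(X)$, where $\sigma\times\eta^*$ is the ultraweakly continuous completely contractive representation of $H^\infty(E)$ on $H$ with $\varphi_\infty(a)\mapsto\sigma(a)$ and $T_x\mapsto\eta^*(x\otimes\cdot)$. A biholomorphic self-map $g$ of $\mathbb D((E^\sigma)^*)$ implements $\alpha\in\mathrm{Aut}(H^\infty(E))$ if $\widehat{\alpha(X)}(\eta^*)=\widehat X(g(\eta^*))$ for all $X\in H^\infty(E)$ and $\eta^*\in\mathbb D((E^\sigma)^*)$. Let $\mathbb P$ be the set of pairs $(U,\eta^*)$, with $U$ an invertible element of the commutant $\sigma(A)'$ and $\eta^*\in(E^\sigma)^*$, modulo the relation $(U,\eta^*)\sim(CU,C\eta^*)$ for invertible $C\in\sigma(A)'$. Write $[U\ \ \eta^*]$ for the class of $(U,\eta^*)$, which is also regarded as a $1\times2$ block matrix. For $\gamma\in E^\sigma$ with $\|\gamma\|<1$ let $\Delta_\gamma=(I_H-\gamma^*\gamma)^{1/2}$, $\Delta_{\gamma^*}=(I_{E\otimes_\sigma H}-\gamma\gamma^*)^{1/2}$ and $$g_\gamma(\eta^*)=\Delta_\gamma(I_H-\eta^*\gamma)^{-1}(\gamma^*-\eta^*)\Delta_{\gamma^*}^{-1}.$$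 **Theorem.** Suppose that a biholomorphic self-map $g$ of $\mathbb D((E^\sigma)^*)$ implements some $\alpha\in\mathrm{Aut}(H^\infty(E))$ and has the form $g(\eta^*)=g_\gamma(\eta^*)(u\otimes I_H)$ for all $\eta^*\in\mathbb D((E^\sigma)^*)$, with $\gamma\in E^\sigma$, $\|\gamma\|<1$, and $u\in\mathcal L(E)$ unitary. Put $$T=\begin{pmatrix}\Delta_\gamma^{-1}&\gamma^*\Delta_{\gamma^*}^{-1}(u\otimes I_H)\\-\gamma\Delta_\gamma^{-1}&-\Delta_{\gamma^*}^{-1}(u\otimes I_H)\end{pmatrix}.$$ Then for every $\eta^*\in\mathbb D((E^\sigma)^*)$ the row $(I_H\ \ \eta^*)\,T$ consists of an invertible element of $\sigma(A)'$ and an element of $(E^\sigma)^*$, and in $\mathbb P$ $$[I_H\ \ \eta^*]\,T=[I_H\ \ g(\eta^*)].$$ Moreover, this does not depend on the representative: for every $(U,\xi^*)\sim(I_H,\eta^*)$ the row $(U\ \ \xi^*)\,T$ again consists of an invertible element of $\sigma(A)'$ and an element of $(E^\sigma)^*$, and its class in $\mathbb P$ is $[I_H\ \ g(\eta^*)]$.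 -/

import Mathlib

open scoped TensorProduct InnerProductSpace ComplexOrder
open MulOpposite (op)

set_option linter.unusedSectionVars false

universe u v w

noncomputable section

namespace Hardy

/-- A right Hilbert C⋆-module over `A`, i.e. a right `A`-module (a module over `Aᵐᵒᵖ`, `op a • x`
being `x · a`) with an `A`-valued inner product, linear in the second variable, which induces the
norm of `E`. (Mathlib's `CStarModule` is the left-module variant.) -/
class RightCStarModule (A E : Type*) [CStarAlgebra A] [PartialOrder A] [StarOrderedRing A]
    [NormedAddCommGroup E] [NormedSpace ℂ E] [CompleteSpace E] [Module Aᵐᵒᵖ E] where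
  ip : E → E → A
  ip_add_right : ∀ x y z, ip x (y + z) = ip x y + ip x z
  ip_smul_right : ∀ (c : ℂ) x y, ip x (c • y) = c • ip x y
  ip_op_smul_right : ∀ (a : A) x y, ip x (op a • y) = ip x y * a
  star_ip : ∀ x y, star (ip x y) = ip y x
  ip_self_nonneg : ∀ x, 0 ≤ ip x x
  norm_eq_sqrt : ∀ x, ‖x‖ = √‖ip x x‖

open RightCStarModule

section Module

variable {A E : Type*} [CStarAlgebra A] [PartialOrder A] [StarOrderedRing A]
    [NormedAddCommGroup E] [NormedSpace ℂ E] [CompleteSpace E] [Module Aᵐᵒᵖ E]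
    [RightCStarModule A E]

lemma ip_add_left (x y z : E) : (ip (x + y) z : A) = ip x z + ip y z := by
  rw [← star_ip, ip_add_right, star_add, star_ip, star_ip]

lemma ip_smul_left (c : ℂ) (x y : E) : (ip (c • x) y : A) = star c • ip x y := by
  rw [← star_ip, ip_smul_right, star_smul, star_ip]

lemma ip_op_smul_left (a : A) (x y : E) : ip (op a • x) y = star a * ip x y := by
  rw [← star_ip, ip_op_smul_right, star_mul, star_ip]

lemma ip_sum_right {ι : Type*} (s : Finset ι) (x : E) (y : ι → E) :
    (ip x (∑ i ∈ s, y i) : A) = ∑ i ∈ s, ip x (y i) :=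
  map_sum (AddMonoidHom.mk' (fun z => (ip x z : A)) (ip_add_right x)) y s

lemma ip_sum_left {ι : Type*} (s : Finset ι) (x : ι → E) (y : E) :
    (ip (∑ i ∈ s, x i) y : A) = ∑ i ∈ s, ip (x i) y :=
  map_sum (AddMonoidHom.mk' (fun z => (ip z y : A)) (fun a b => ip_add_left a b y)) x s

lemma norm_sq_eq (x : E) : ‖x‖ ^ 2 = ‖(ip x x : A)‖ := by
  rw [norm_eq_sqrt (A := A) x, Real.sq_sqrt (norm_nonneg _)]

/-- A bounded operator on `E` that commutes with the right action of `A`. -/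
def IsModuleMap (A : Type*) {E : Type*} [CStarAlgebra A] [NormedAddCommGroup E] [NormedSpace ℂ E]
    [Module Aᵐᵒᵖ E] (T : E →L[ℂ] E) : Prop :=
  ∀ (x : E) (a : A), T (op a • x) = op a • T x

lemma ip_map_le (T : E →L[ℂ] E) (hT : IsModuleMap A T) (y : E) :
    (ip (T y) (T y) : A) ≤ algebraMap ℝ A (‖T‖ ^ 2) * ip y y := by
  set p : A := ip y y with hp
  set q : A := ip (T y) (T y) with hq
  have hp0 : 0 ≤ p := ip_self_nonneg y
  have hq0 : 0 ≤ q := ip_self_nonneg _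
  have key : ∀ ε : ℝ, 0 < ε → q ≤ algebraMap ℝ A (‖T‖ ^ 2) * (p + algebraMap ℝ A ε) := by
    intro ε hε
    have hε' : IsStrictlyPositive (algebraMap ℝ A ε) := by
      rw [IsStrictlyPositive.iff_of_unital]
      exact ⟨by exact algebraMap_nonneg A hε.le, (IsUnit.mk0 ε hε.ne').map (algebraMap ℝ A)⟩
    have hc : IsStrictlyPositive (p + algebraMap ℝ A ε) := hε'.nonneg_add hp0
    set c := p + algebraMap ℝ A ε with hcdef
    have hs : IsUnit (CFC.sqrt c) := CFC.isUnit_sqrt_iff_isStrictlyPositive.mpr hc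
    obtain ⟨s, hs⟩ := hs
    have hsa : IsSelfAdjoint (s : A) := by
      rw [hs]; exact (CFC.sqrt_nonneg c).isSelfAdjoint
    have hss : (s : A) * s = c := by rw [hs]; exact CFC.sqrt_mul_sqrt_self c hc.nonneg
    set b : A := ((s⁻¹ : Aˣ) : A) with hb
    have hbs : b * s = 1 := s.inv_mul
    have hsb : (s : A) * b = 1 := s.mul_inv
    have hba : star b = b := by
      have h1 : star b * s = 1 := by
        have := congrArg star hsb
        simpa [hsa.star_eq] using this
      calc star b = star b * (s * b) := by rw [hsb, mul_one]
        _ = b := by rw [← mul_assoc, h1, one_mul]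
    have hbcb : b * c * b = 1 := by rw [← hss]; simp [hbs, hsb, ← mul_assoc]
    have hbpb : b * p * b ≤ 1 := by
      rw [← hbcb]
      have := star_left_conjugate_le_conjugate (a := p) (b := c)
        (by rw [hcdef]; exact le_add_of_nonneg_right hε'.nonneg) b
      simpa [hba] using this
    have hyb : (ip (op b • y) (op b • y) : A) = b * p * b := by
      rw [ip_op_smul_left, ip_op_smul_right, hba, mul_assoc]
    have hTb : (ip (T (op b • y)) (T (op b • y)) : A) = b * q * b := by
      rw [hT, ip_op_smul_left, ip_op_smul_right, hba, mul_assoc]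
    have hny : ‖op b • y‖ ≤ 1 := by
      have h0 : 0 ≤ b * p * b := by rw [← hyb]; exact ip_self_nonneg _
      have : ‖op b • y‖ ^ 2 ≤ 1 := by
        rw [norm_sq_eq (A := A), hyb]
        exact (CStarAlgebra.norm_le_one_iff_of_nonneg _ h0).2 hbpb
      nlinarith [norm_nonneg (op b • y)]
    have hnT : ‖b * q * b‖ ≤ ‖T‖ ^ 2 := by
      rw [← hTb, ← norm_sq_eq]
      have : ‖T (op b • y)‖ ≤ ‖T‖ := (T.le_opNorm _).trans (by nlinarith [norm_nonneg T])
      gcongr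
    have h0 : 0 ≤ b * q * b := by rw [← hTb]; exact ip_self_nonneg _
    have h1 := (CStarAlgebra.norm_le_iff_le_algebraMap _ (by positivity) h0).1 hnT
    have h2 := star_left_conjugate_le_conjugate h1 (s : A)
    rw [hsa.star_eq] at h2
    have h3 : (s : A) * (b * q * b) * s = q := by
      calc (s : A) * (b * q * b) * s = (s * b) * q * (b * s) := by simp only [mul_assoc]
        _ = q := by rw [hsb, hbs, one_mul, mul_one]
    rw [h3, ← Algebra.commutes, mul_assoc, hss] at h2
    exact h2
  have hlim : Filter.Tendsto (fun ε : ℝ => algebraMap ℝ A (‖T‖ ^ 2) * (p + algebraMap ℝ A ε))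
      (nhdsWithin 0 (Set.Ioi 0)) (nhds (algebraMap ℝ A (‖T‖ ^ 2) * (p + algebraMap ℝ A 0))) := by
    apply Filter.Tendsto.mono_left _ nhdsWithin_le_nhds
    apply Continuous.tendsto
    have := continuous_algebraMap ℝ A
    fun_prop
  rw [map_zero, add_zero] at hlim
  exact ge_of_tendsto hlim (by filter_upwards [self_mem_nhdsWithin] with ε hε using key ε hε)

end Module

section Positivity

variable {A H : Type*} [CStarAlgebra A] [PartialOrder A] [StarOrderedRing A]
  [NormedAddCommGroup H] [InnerProductSpace ℂ H] [CompleteSpace H]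

lemma exists_neg {B : Type*} [CStarAlgebra B] [PartialOrder B] [StarOrderedRing B] (G : B)
    (hG : IsSelfAdjoint G) :
    ∃ N C : B, N = star C * C ∧ star N = N ∧ N * G * N = -(N * N * N) ∧
      (N * N * N = 0 → 0 ≤ G) := by
  have hn : 0 ≤ G⁻ := CFC.negPart_nonneg G
  have hna : star G⁻ = G⁻ := hn.isSelfAdjoint.star_eq
  obtain ⟨C, hC⟩ := CStarAlgebra.nonneg_iff_eq_star_mul_self.1 hn
  have hG' := CFC.posPart_sub_negPart G hG
  refine ⟨G⁻, C, hC, hna, ?_, ?_⟩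
  · have h1 : G⁻ * G = - (G⁻ * G⁻) := by
      nth_rewrite 2 [← hG']
      rw [mul_sub, CFC.negPart_mul_posPart, zero_sub]
    rw [h1, neg_mul]
  · intro h
    have h2 : G⁻ * G⁻ = 0 := by
      rw [← CStarRing.star_mul_self_eq_zero_iff, star_mul, hna, ← mul_assoc, h, zero_mul]
    have h3 : G⁻ = 0 := by
      rw [← CStarRing.star_mul_self_eq_zero_iff, hna, h2]
    rw [← hG', h3, sub_zero]
    exact CFC.posPart_nonneg G

lemma exists_sq {B : Type*} [CStarAlgebra B] [PartialOrder B] [StarOrderedRing B] (G : B)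
    (hG : 0 ≤ G) : ∃ C, G = star C * C := CStarAlgebra.nonneg_iff_eq_star_mul_self.1 hG

lemma matrix_nonneg {n : ℕ} (G : CStarMatrix (Fin n) (Fin n) A) (hG : IsSelfAdjoint G)
    (h : ∀ b : Fin n → A, 0 ≤ ∑ i, ∑ j, star (b i) * G i j * b j) : 0 ≤ G := by
  obtain ⟨N, C, hC, hN, h1, h2⟩ := exists_neg G hG
  apply h2
  have hD : N * N * N = star (C * N) * (C * N) := by
    rw [star_mul, hN]
    nth_rewrite 2 [hC]
    simp only [mul_assoc]
  have hz : ∀ l k, (C * N) l k = 0 := by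
    intro l k
    have e1 : (N * G * N) k k = ∑ i, ∑ j, star (N i k) * G i j * N j k := by
      have : ∀ i, N k i = star (N i k) := fun i => by
        conv_lhs => rw [← hN, CStarMatrix.star_apply]
      simp only [CStarMatrix.mul_apply, Finset.sum_mul, this]
      rw [Finset.sum_comm]
    have e2 : (N * N * N) k k = ∑ i, star ((C * N) i k) * (C * N) i k := by
      rw [hD, CStarMatrix.mul_apply]
      simp only [CStarMatrix.star_apply]
    have e3 : (N * G * N) k k = - (N * N * N) k k := by rw [h1]; rfl
    have e4 := h (fun i => N i k)
    rw [← e1, e3, e2] at e4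
    have e5 : ∀ i ∈ Finset.univ, 0 ≤ star ((C * N) i k) * (C * N) i k :=
      fun i _ => star_mul_self_nonneg _
    have e6 := le_antisymm (neg_nonneg.1 e4) (Finset.sum_nonneg e5)
    have e7 := (Finset.sum_eq_zero_iff_of_nonneg e5).1 e6 l (Finset.mem_univ _)
    exact (CStarRing.star_mul_self_eq_zero_iff _).1 e7
  have : C * N = 0 := by ext l k; exact hz l k
  rw [hD, this, mul_zero]

lemma inner_star_mul (σ : A →⋆ₐ[ℂ] (H →L[ℂ] H)) (a b : A) (x y : H) :
    ⟪x, σ (star a * b) y⟫_ℂ = ⟪σ a x, σ b y⟫_ℂ := by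
  have h1 : σ (star a * b) = σ (star a) * σ b := map_mul σ _ _
  have h2 : σ (star a) = ContinuousLinearMap.adjoint (σ a) := map_star σ a
  rw [h1, h2, mul_apply_eq_comp]
  exact ContinuousLinearMap.adjoint_inner_right _ _ _

lemma gram_nonneg (σ : A →⋆ₐ[ℂ] (H →L[ℂ] H)) {n : ℕ} (C : Fin n → Fin n → A) (k : Fin n → H) :
    0 ≤ ∑ i, ∑ j, ⟪k i, σ (∑ l, star (C l i) * C l j) (k j)⟫_ℂ := by
  have e : ∀ i j, ⟪k i, σ (∑ l, star (C l i) * C l j) (k j)⟫_ℂ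
      = ∑ l, ⟪σ (C l i) (k i), σ (C l j) (k j)⟫_ℂ := by
    intro i j
    rw [map_sum σ, sum_apply, inner_sum]
    exact Finset.sum_congr rfl fun l _ => inner_star_mul σ _ _ _ _
  have e2 : ∀ l, ⟪∑ i, σ (C l i) (k i), ∑ i, σ (C l i) (k i)⟫_ℂ
      = ∑ i, ∑ j, ⟪σ (C l i) (k i), σ (C l j) (k j)⟫_ℂ := by
    intro l
    rw [sum_inner]
    exact Finset.sum_congr rfl fun i _ => inner_sum _ _ _
  have e3 : ∑ i, ∑ j, ⟪k i, σ (∑ l, star (C l i) * C l j) (k j)⟫_ℂ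
      = ∑ l, ⟪∑ i, σ (C l i) (k i), ∑ i, σ (C l i) (k i)⟫_ℂ := by
    simp_rw [e, e2]
    rw [Finset.sum_comm (s := Finset.univ (α := Fin n)) (f := fun l i =>
      ∑ j, ⟪σ (C l i) (k i), σ (C l j) (k j)⟫_ℂ)]
    exact Finset.sum_congr rfl fun i _ => Finset.sum_comm
  rw [e3]
  exact Finset.sum_nonneg fun l _ => by
    rw [inner_self_eq_norm_sq_to_K]
    rw [← RCLike.ofReal_pow]
    exact Complex.zero_le_real.2 (sq_nonneg ‖∑ i, σ (C l i) (k i)‖)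

lemma kernel_nonneg (σ : A →⋆ₐ[ℂ] (H →L[ℂ] H)) {n : ℕ} (G : Fin n → Fin n → A)
    (hG : ∀ i j, star (G i j) = G j i)
    (h : ∀ b : Fin n → A, 0 ≤ ∑ i, ∑ j, star (b i) * G i j * b j) (k : Fin n → H) :
    0 ≤ ∑ i, ∑ j, ⟪k i, σ (G i j) (k j)⟫_ℂ := by
  have h0 : 0 ≤ CStarMatrix.ofMatrix (Matrix.of G) :=
    matrix_nonneg _ (by ext i j; exact hG j i) h
  obtain ⟨C, hC⟩ := exists_sq _ h0
  have hC' : ∀ i j, G i j = ∑ l, star (C l i) * C l j := by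
    intro i j
    have : G i j = (star C * C) i j := by rw [← hC]; rfl
    rw [this, CStarMatrix.mul_apply]
    simp only [CStarMatrix.star_apply]
  simp only [hC']
  exact gram_nonneg σ (fun i j => C i j) k

end Positivity

section Interior

variable {A E H : Type*} [CStarAlgebra A] [PartialOrder A] [StarOrderedRing A]
  [NormedAddCommGroup E] [NormedSpace ℂ E] [CompleteSpace E] [Module Aᵐᵒᵖ E]
  [RightCStarModule A E]
  [NormedAddCommGroup H] [InnerProductSpace ℂ H] [CompleteSpace H]

/-- The algebraic tensor product of `E` and `H`, on which the representation `σ` induces a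
positive semidefinite inner product. -/
def PreTensor (E : Type*) {A H : Type*} [CStarAlgebra A] [NormedAddCommGroup E] [NormedSpace ℂ E]
    [NormedAddCommGroup H] [InnerProductSpace ℂ H] [CompleteSpace H]
    (_σ : A →⋆ₐ[ℂ] (H →L[ℂ] H)) : Type _ := E ⊗[ℂ] H

variable (E) in
/-- The form `⟨x ⊗ h, y ⊗ k⟩ = ⟨h, σ(⟨x, y⟩) k⟩` on the algebraic tensor product. -/
def tensorForm (σ : A →⋆ₐ[ℂ] (H →L[ℂ] H)) : E ⊗[ℂ] H →ₗ⋆[ℂ] E ⊗[ℂ] H →ₗ[ℂ] ℂ :=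
  TensorProduct.lift <| LinearMap.mk₂'ₛₗ (starRingEnd ℂ) (starRingEnd ℂ)
    (fun x h => TensorProduct.lift <| LinearMap.mk₂ ℂ (fun y k => ⟪h, σ (ip x y) k⟫_ℂ)
      (fun y y' k => by simp [ip_add_right])
      (fun c y k => by simp [ip_smul_right])
      (fun y k k' => by simp)
      (fun c y k => by simp))
    (fun x x' h => by ext y k; simp [ip_add_left])
    (fun c x h => by ext y k; simp [ip_smul_left])
    (fun x h h' => by ext y k; simp)
    (fun c x h => by ext y k; simp [mul_comm])

@[simp] lemma tensorForm_tmul (σ : A →⋆ₐ[ℂ] (H →L[ℂ] H)) (x y : E) (h k : H) :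
    tensorForm E σ (x ⊗ₜ h) (y ⊗ₜ k) = ⟪h, σ (ip x y) k⟫_ℂ := rfl

lemma exists_fin_sum (v : E ⊗[ℂ] H) :
    ∃ (n : ℕ) (x : Fin n → E) (h : Fin n → H), v = ∑ i, x i ⊗ₜ[ℂ] h i := by
  obtain ⟨n, x, h, e⟩ := TensorProduct.exists_sum_tmul_eq v
  exact ⟨n, x, h, e⟩

lemma tensorForm_sum (σ : A →⋆ₐ[ℂ] (H →L[ℂ] H)) {n : ℕ} (x : Fin n → E) (h : Fin n → H) :
    tensorForm E σ (∑ i, x i ⊗ₜ h i) (∑ i, x i ⊗ₜ h i)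
      = ∑ i, ∑ j, ⟪h i, σ (ip (x i) (x j)) (h j)⟫_ℂ := by
  simp only [map_sum, LinearMap.sum_apply, tensorForm_tmul]
  exact Finset.sum_comm

lemma tensorForm_symm (σ : A →⋆ₐ[ℂ] (H →L[ℂ] H)) (v w : E ⊗[ℂ] H) :
    starRingEnd ℂ (tensorForm E σ w v) = tensorForm E σ v w := by
  induction v with
  | zero => simp
  | add v v' hv hv' => simp [hv, hv']
  | tmul x h =>
    induction w with
    | zero => simp
    | add w w' hw hw' => simp [hw, hw']
    | tmul y k =>
      rw [tensorForm_tmul, tensorForm_tmul, inner_conj_symm, ← star_ip y x, map_star σ,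
        ContinuousLinearMap.star_eq_adjoint, ContinuousLinearMap.adjoint_inner_right]

lemma ip_sum_op {n : ℕ} (x : Fin n → E) (b : Fin n → A) :
    ∑ i, ∑ j, star (b i) * ip (x i) (x j) * b j
      = ip (∑ i, op (b i) • x i) (∑ i, op (b i) • x i) := by
  rw [ip_sum_left]
  refine Finset.sum_congr rfl fun i _ => ?_
  rw [ip_sum_right]
  refine Finset.sum_congr rfl fun j _ => ?_
  rw [ip_op_smul_left, ip_op_smul_right, mul_assoc]

lemma tensorForm_nonneg (σ : A →⋆ₐ[ℂ] (H →L[ℂ] H)) (v : E ⊗[ℂ] H) :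
    0 ≤ tensorForm E σ v v := by
  obtain ⟨n, x, h, rfl⟩ := exists_fin_sum v
  rw [tensorForm_sum]
  refine kernel_nonneg σ _ (fun i j => star_ip _ _) (fun b => ?_) h
  rw [ip_sum_op]
  exact ip_self_nonneg _

lemma tensorForm_map_le (σ : A →⋆ₐ[ℂ] (H →L[ℂ] H)) (T : E →L[ℂ] E) (hT : IsModuleMap A T)
    (v : E ⊗[ℂ] H) :
    tensorForm E σ (TensorProduct.map (T : E →ₗ[ℂ] E) LinearMap.id v)
      (TensorProduct.map (T : E →ₗ[ℂ] E) LinearMap.id v) ≤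
      ((‖T‖ ^ 2 : ℝ) : ℂ) * tensorForm E σ v v := by
  obtain ⟨n, x, h, rfl⟩ := exists_fin_sum v
  have e : TensorProduct.map (T : E →ₗ[ℂ] E) LinearMap.id (∑ i, x i ⊗ₜ[ℂ] h i)
      = ∑ i, T (x i) ⊗ₜ[ℂ] h i := by simp
  rw [e, tensorForm_sum, tensorForm_sum, ← sub_nonneg, Finset.mul_sum, ← Finset.sum_sub_distrib]
  have hr : ∀ a : A, algebraMap ℝ A (‖T‖ ^ 2) * a = ((‖T‖ ^ 2 : ℝ) : ℂ) • a := fun a => by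
    rw [← Algebra.smul_def, Complex.coe_smul]
  have := kernel_nonneg σ
    (fun i j => ((‖T‖ ^ 2 : ℝ) : ℂ) • ip (x i) (x j) - ip (T (x i)) (T (x j)))
    (fun i j => by
      rw [star_sub, star_smul, star_ip, star_ip]; simp) (fun b => ?_) h
  · convert this using 2 with i
    rw [Finset.mul_sum, ← Finset.sum_sub_distrib]
    refine Finset.sum_congr rfl fun j _ => ?_
    rw [map_sub σ, map_smul σ, sub_apply, smul_apply, inner_sub_right, inner_smul_right]
  · have h1 := ip_sum_op x b
    have h2 := ip_sum_op (fun i => T (x i)) b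
    have h3 : ∑ i, op (b i) • T (x i) = T (∑ i, op (b i) • x i) := by
      rw [map_sum]; exact Finset.sum_congr rfl fun i _ => (hT _ _).symm
    rw [h3] at h2
    have h4 := ip_map_le T hT (∑ i, op (b i) • x i)
    rw [hr, ← h1, ← h2, ← sub_nonneg] at h4
    convert h4 using 1
    simp only [mul_sub, sub_mul, Finset.sum_sub_distrib, Finset.smul_sum, mul_smul_comm,
      smul_mul_assoc]

section
variable (σ : A →⋆ₐ[ℂ] (H →L[ℂ] H))

instance : AddCommGroup (PreTensor E σ) := inferInstanceAs (AddCommGroup (E ⊗[ℂ] H))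
instance : Module ℂ (PreTensor E σ) := inferInstanceAs (Module ℂ (E ⊗[ℂ] H))

@[reducible] def preCore : PreInnerProductSpace.Core ℂ (PreTensor E σ) where
  inner v w := tensorForm E σ v w
  conj_inner_symm v w := tensorForm_symm σ v w
  re_inner_nonneg v := (Complex.le_def.1 (tensorForm_nonneg σ v)).1
  add_left u v w := by exact LinearMap.map_add₂ _ _ _ _
  smul_left u v c := by exact LinearMap.map_smulₛₗ₂ _ _ _ _

instance : SeminormedAddCommGroup (PreTensor E σ) :=
  @InnerProductSpace.Core.toSeminormedAddCommGroup ℂ _ _ _ _ (preCore σ)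

instance : InnerProductSpace ℂ (PreTensor E σ) := InnerProductSpace.ofCore (preCore σ)

lemma pre_inner_def (v w : PreTensor E σ) : ⟪v, w⟫_ℂ = tensorForm E σ v w := rfl

variable (E) in
/-- The Hilbert space `E ⊗_σ H`: the Hausdorff completion of `E ⊗ H` for the inner product
`⟨x ⊗ h, y ⊗ k⟩ = ⟨h, σ(⟨x, y⟩) k⟩`. -/
def InteriorTensor : Type _ := UniformSpace.Completion (PreTensor E σ)

instance : NormedAddCommGroup (InteriorTensor E σ) :=
  inferInstanceAs (NormedAddCommGroup (UniformSpace.Completion (PreTensor E σ)))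

instance : InnerProductSpace ℂ (InteriorTensor E σ) :=
  inferInstanceAs (InnerProductSpace ℂ (UniformSpace.Completion (PreTensor E σ)))

instance : CompleteSpace (InteriorTensor E σ) :=
  inferInstanceAs (CompleteSpace (UniformSpace.Completion (PreTensor E σ)))

/-- The elementary tensor `x ⊗ h` in `E ⊗ H`. -/
def preTmul (x : E) (h : H) : PreTensor E σ := (x ⊗ₜ[ℂ] h : E ⊗[ℂ] H)

/-- The elementary tensor `x ⊗ h` in `E ⊗_σ H`. -/
def tmul (x : E) (h : H) : InteriorTensor E σ := (preTmul σ x h : UniformSpace.Completion (PreTensor E σ))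

lemma inner_tmul (x y : E) (h k : H) : ⟪tmul σ x h, tmul σ y k⟫_ℂ = ⟪h, σ (ip x y) k⟫_ℂ := by
  exact UniformSpace.Completion.inner_coe (preTmul σ x h) (preTmul σ y k)

lemma norm_sq_pre (v : PreTensor E σ) : ((‖v‖ ^ 2 : ℝ) : ℂ) = tensorForm E σ v v := by
  rw [← pre_inner_def, inner_self_eq_norm_sq_to_K]; push_cast; rfl

/-- The operator `T ⊗ I_H` on the algebraic tensor product. -/
def preTensorId (T : E →L[ℂ] E) (hT : IsModuleMap A T) : PreTensor E σ →L[ℂ] PreTensor E σ :=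
  LinearMap.mkContinuous
    (show PreTensor E σ →ₗ[ℂ] PreTensor E σ from
      TensorProduct.map (T : E →ₗ[ℂ] E) (LinearMap.id : H →ₗ[ℂ] H)) ‖T‖ (fun v => by
    have h := tensorForm_map_le σ T hT v
    have h1 := norm_sq_pre σ v
    have h2 := norm_sq_pre σ (show PreTensor E σ from
      TensorProduct.map (T : E →ₗ[ℂ] E) (LinearMap.id : H →ₗ[ℂ] H) v)
    erw [← h1, ← h2] at h
    rw [← Complex.ofReal_mul, Complex.real_le_real] at h
    refine le_of_sq_le_sq ?_ (by positivity)
    rw [mul_pow]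
    exact h)

/-- The operator `T ⊗ I_H` on `E ⊗_σ H`, for a bounded module map `T` of `E`. -/
def tensorId (T : E →L[ℂ] E) (hT : IsModuleMap A T) :
    InteriorTensor E σ →L[ℂ] InteriorTensor E σ :=
  show UniformSpace.Completion (PreTensor E σ) →L[ℂ] UniformSpace.Completion (PreTensor E σ) from
    (preTensorId σ T hT).completion

@[simp] lemma tensorId_tmul (T : E →L[ℂ] E) (hT : IsModuleMap A T) (x : E) (h : H) :
    tensorId σ T hT (tmul σ x h) = tmul σ (T x) h := by
  exact ContinuousLinearMap.completion_apply_coe (preTensorId σ T hT) (preTmul σ x h)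

lemma tmul_add_right (x : E) (h k : H) : tmul σ x (h + k) = tmul σ x h + tmul σ x k := by
  have : preTmul σ x (h + k) = preTmul σ x h + preTmul σ x k := TensorProduct.tmul_add _ _ _
  rw [tmul, this]; exact UniformSpace.Completion.coe_add _ _

lemma tmul_smul_right (x : E) (c : ℂ) (h : H) : tmul σ x (c • h) = c • tmul σ x h := by
  have : preTmul σ x (c • h) = c • preTmul σ x h := TensorProduct.tmul_smul _ _ _
  rw [tmul, this]; exact UniformSpace.Completion.coe_smul _ _

lemma tmul_add_left (x y : E) (h : H) : tmul σ (x + y) h = tmul σ x h + tmul σ y h := by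
  have : preTmul σ (x + y) h = preTmul σ x h + preTmul σ y h := TensorProduct.add_tmul _ _ _
  rw [tmul, this]; exact UniformSpace.Completion.coe_add _ _

lemma tmul_smul_left (c : ℂ) (x : E) (h : H) : tmul σ (c • x) h = c • tmul σ x h := by
  have : preTmul σ (c • x) h = c • preTmul σ x h := rfl
  rw [tmul, this]; exact UniformSpace.Completion.coe_smul _ _

lemma norm_tmul_le (x : E) (h : H) : ‖tmul σ x h‖ ≤ ‖x‖ * ‖h‖ := by
  have h1 : ‖tmul σ x h‖ ^ 2 ≤ (‖x‖ * ‖h‖) ^ 2 := by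
    rw [← inner_self_eq_norm_sq (𝕜 := ℂ), inner_tmul]
    calc _ ≤ ‖⟪h, σ (ip x x) h⟫_ℂ‖ := RCLike.re_le_norm _
      _ ≤ ‖h‖ * (‖(ip x x : A)‖ * ‖h‖) := by
        refine (norm_inner_le_norm _ _).trans ?_
        gcongr
        refine ((σ (ip x x)).le_opNorm h).trans ?_
        gcongr
        exact NonUnitalStarAlgHom.norm_apply_le σ _
      _ = _ := by rw [← norm_sq_eq]; ring
  exact le_of_sq_le_sq h1 (by positivity)

/-- Two bounded operators on `E ⊗_σ H` agree if they agree on elementary tensors. -/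
lemma clm_ext {F : Type*} [NormedAddCommGroup F] [NormedSpace ℂ F]
    {S T : InteriorTensor E σ →L[ℂ] F} (h : ∀ x k, S (tmul σ x k) = T (tmul σ x k)) : S = T := by
  ext v
  refine UniformSpace.Completion.induction_on
    (p := fun v : UniformSpace.Completion (PreTensor E σ) => S v = T v) v
    (isClosed_eq S.continuous T.continuous) fun v => ?_
  let ι : E ⊗[ℂ] H → InteriorTensor E σ := fun v =>
    ((show PreTensor E σ from v : PreTensor E σ) : UniformSpace.Completion (PreTensor E σ))
  have h0 : ι 0 = 0 := UniformSpace.Completion.coe_zero (α := PreTensor E σ)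
  have hadd : ∀ v w, ι (v + w) = ι v + ι w := fun v w =>
    UniformSpace.Completion.coe_add (α := PreTensor E σ) v w
  have : ∀ v : E ⊗[ℂ] H, S (ι v) = T (ι v) := by
    intro v
    induction v with
    | zero => rw [h0, map_zero, map_zero]
    | add v w hv hw => rw [hadd, map_add, map_add, hv, hw]
    | tmul x k => exact h x k
  exact this v

/-- The creation map `h ↦ x ⊗ h` from `H` to `E ⊗_σ H`. -/
def tmulL (x : E) : H →L[ℂ] InteriorTensor E σ :=
  LinearMap.mkContinuous
    { toFun := fun h => tmul σ x h
      map_add' := tmul_add_right σ x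
      map_smul' := fun c h => tmul_smul_right σ x c h } ‖x‖ (norm_tmul_le σ x)

@[simp] lemma tmulL_apply (x : E) (h : H) : tmulL σ x h = tmul σ x h := rfl

end

end Interior

section Correspondence

/-- A W⋆-correspondence over the W⋆-algebra `A`: a selfdual right Hilbert module `E` over `A` with
a unital normal `*`-homomorphism `act` from `A` to the adjointable operators of `E`. Normality is
expressed through the functionals: an increasing net `Tᵢ` of adjointable operators has supremum `T`
if and only if `⟨x, Tᵢ x⟩` has supremum `⟨x, T x⟩` in `A` for every `x`. -/
class WStarCorrespondence (A E : Type*) [CStarAlgebra A] [PartialOrder A] [StarOrderedRing A]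
    [WStarAlgebra A] [NormedAddCommGroup E] [NormedSpace ℂ E] [CompleteSpace E] [Module Aᵐᵒᵖ E]
    extends RightCStarModule A E where
  selfDual : ∀ f : E →L[ℂ] A, (∀ (x : E) (a : A), f (op a • x) = f x * a) →
    ∃ y, ∀ x, f x = ip y x
  act : A →ₐ[ℂ] (E →L[ℂ] E)
  ip_act_left : ∀ (a : A) (x y : E), ip (act a x) y = ip x (act (star a) y)
  act_normal : ∀ x : E, ScottContinuous fun a : A => ip x (act a x)

open WStarCorrespondence

variable {A E H : Type*} [CStarAlgebra A] [PartialOrder A] [StarOrderedRing A] [WStarAlgebra A]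
  [NormedAddCommGroup E] [NormedSpace ℂ E] [CompleteSpace E] [Module Aᵐᵒᵖ E]
  [WStarCorrespondence A E]
  [NormedAddCommGroup H] [InnerProductSpace ℂ H] [CompleteSpace H]

lemma ip_ext {x y : E} (h : ∀ z : E, (ip z x : A) = ip z y) : x = y := by
  have h1 : (ip (x - y) (x - y) : A) = 0 := by
    have h2 := ip_add_right (A := A) (x - y) (x - y) y
    rw [sub_add_cancel, h] at h2
    exact left_eq_add.1 (by rw [add_comm]; exact h2)
  have h2 := norm_sq_eq (A := A) (x - y)
  rw [h1, norm_zero] at h2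
  exact sub_eq_zero.1 (norm_eq_zero.1 (pow_eq_zero_iff (two_ne_zero) |>.1 h2))

/-- `T` and `S` are adjoint operators on `E`: `⟨T x, y⟩ = ⟨x, S y⟩`. -/
def IsAdjointPair (A : Type*) {E : Type*} [CStarAlgebra A] [PartialOrder A] [StarOrderedRing A]
    [NormedAddCommGroup E] [NormedSpace ℂ E] [CompleteSpace E] [Module Aᵐᵒᵖ E]
    [RightCStarModule A E] (T S : E →L[ℂ] E) : Prop :=
  ∀ x y : E, (ip (T x) y : A) = ip x (S y)

lemma IsAdjointPair.isModuleMap {T S : E →L[ℂ] E} (h : IsAdjointPair A T S) : IsModuleMap A T := by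
  intro x a
  apply ip_ext (A := A)
  intro z
  have h' : ∀ z y : E, (ip z (T y) : A) = ip (S z) y := fun z y => by
    rw [← star_ip, h, star_ip]
  rw [h', ip_op_smul_right, ip_op_smul_right, h']

/-- The unitary elements of the algebra of adjointable operators of `E`. -/
structure UnitaryOp (A E : Type*) [CStarAlgebra A] [PartialOrder A] [StarOrderedRing A]
    [NormedAddCommGroup E] [NormedSpace ℂ E] [CompleteSpace E] [Module Aᵐᵒᵖ E]
    [RightCStarModule A E] where
  val : E →L[ℂ] E
  adj : E →L[ℂ] E
  isAdjointPair : IsAdjointPair A val adj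
  val_adj : val ∘L adj = ContinuousLinearMap.id ℂ E
  adj_val : adj ∘L val = ContinuousLinearMap.id ℂ E

lemma act_isAdjointPair (a : A) : IsAdjointPair A (act a : E →L[ℂ] E) (act (star a)) :=
  fun x y => ip_act_left a x y

variable (E) in
/-- The representation `a ↦ φ(a) ⊗ I_H` of `A` on `E ⊗_σ H`. -/
def inducedRep (σ : A →⋆ₐ[ℂ] (H →L[ℂ] H)) :
    A →⋆ₐ[ℂ] (InteriorTensor E σ →L[ℂ] InteriorTensor E σ) where
  toFun a := tensorId σ (act a) (act_isAdjointPair a).isModuleMap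
  map_one' := clm_ext σ fun x k => by simp
  map_mul' a b := clm_ext σ fun x k => by simp [mul_apply_eq_comp]
  map_zero' := clm_ext σ fun x k => by
    have : tmul σ (0 : E) k = 0 := by simpa using tmul_smul_left σ 0 (0 : E) k
    simp [this]
  map_add' a b := clm_ext σ fun x k => by simp [tmul_add_left]
  commutes' c := clm_ext σ fun x k => by
    simp [Algebra.algebraMap_eq_smul_one, tmul_smul_left]
  map_star' a := clm_ext σ fun x k => by
    rw [ContinuousLinearMap.star_eq_adjoint, tensorId_tmul]
    refine ext_inner_right ℂ fun w => ?_
    rw [ContinuousLinearMap.adjoint_inner_left]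
    have : (innerSL ℂ (tmul σ x k)) ∘L (tensorId σ (act a) (act_isAdjointPair a).isModuleMap)
        = innerSL ℂ (tmul σ (act (star a) x) k) := clm_ext σ fun y l => by
      simp only [ContinuousLinearMap.comp_apply, tensorId_tmul, innerSL_apply_apply, inner_tmul]
      rw [ip_act_left, star_star]
    exact (congrArg (fun f => f w) this).symm

@[simp] lemma inducedRep_tmul (σ : A →⋆ₐ[ℂ] (H →L[ℂ] H)) (a : A) (x : E) (h : H) :
    inducedRep E σ a (tmul σ x h) = tmul σ (act a x) h :=
  tensorId_tmul σ _ _ x h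

/-- The operator `u ⊗ I_H` on `E ⊗_σ H`. -/
def UnitaryOp.tensorId (σ : A →⋆ₐ[ℂ] (H →L[ℂ] H)) (u : UnitaryOp A E) :
    InteriorTensor E σ →L[ℂ] InteriorTensor E σ :=
  Hardy.tensorId σ u.val u.isAdjointPair.isModuleMap

end Correspondence

section Ultraweak

/-- The ultraweak topology on `B(K)`, generated by the functionals
`T ↦ ∑ₙ ⟨ξₙ, T ζₙ⟩` with `(ξₙ)`, `(ζₙ)` square summable. -/
@[reducible] def ultraweak (K : Type*) [NormedAddCommGroup K] [InnerProductSpace ℂ K] :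
    TopologicalSpace (K →L[ℂ] K) :=
  ⨅ (ξ : lp (fun _ : ℕ => K) 2) (ζ : lp (fun _ : ℕ => K) 2),
    TopologicalSpace.induced (fun T : K →L[ℂ] K => ∑' n, ⟪ξ n, T (ζ n)⟫_ℂ) inferInstance

/-- The norm of a square matrix of bounded operators on `K`, as an operator on `Kⁿ`. -/
def matrixNorm {K : Type*} [NormedAddCommGroup K] [InnerProductSpace ℂ K] [CompleteSpace K]
    {n : ℕ} (X : Matrix (Fin n) (Fin n) (K →L[ℂ] K)) : ℝ :=
  ‖CStarMatrix.ofMatrix X‖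

end Ultraweak

section Fock

/-- A Hilbert space with a unital `*`-representation of `A`. -/
structure HilbertRep (A : Type v) [CStarAlgebra A] where
  carrier : Type u
  [normedAddCommGroup : NormedAddCommGroup carrier]
  [innerProductSpace : InnerProductSpace ℂ carrier]
  [completeSpace : CompleteSpace carrier]
  rep : A →⋆ₐ[ℂ] (carrier →L[ℂ] carrier)

attribute [instance] HilbertRep.normedAddCommGroup HilbertRep.innerProductSpace
  HilbertRep.completeSpace

variable {A : Type v} {E : Type u} [CStarAlgebra A] [PartialOrder A] [StarOrderedRing A]
  [WStarAlgebra A] [NormedAddCommGroup E] [NormedSpace ℂ E] [CompleteSpace E] [Module Aᵐᵒᵖ E]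
  [WStarCorrespondence A E]

variable (E)

/-- The Hilbert space `E^{⊗n} ⊗_π H₀`, as `E ⊗ (E ⊗ ⋯ (E ⊗_π H₀))`, with the left action of `A`. -/
def tensorPower (π : HilbertRep.{u} A) : ℕ → HilbertRep.{u} A
  | 0 => π
  | n + 1 => ⟨InteriorTensor E (tensorPower π n).rep, inducedRep E (tensorPower π n).rep⟩

/-- The Hilbert space `ℱ(E) ⊗_π H₀ = ⨁ₙ E^{⊗n} ⊗_π H₀`. -/
abbrev FockSpace (π : HilbertRep.{u} A) : Type u :=
  lp (fun n => (tensorPower E π n).carrier) 2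

/-- The diagonal operator `φ_∞(a)`. -/
def diagonal (π : HilbertRep.{u} A) (a : A) : FockSpace E π →L[ℂ] FockSpace E π :=
  lp.mapCLM 2 (fun n => (tensorPower E π n).rep a) (norm_nonneg a)
    (fun n => NonUnitalStarAlgHom.norm_apply_le (tensorPower E π n).rep a)

/-- The unilateral shift of a graded Hilbert space by one degree. -/
def shift (G : ℕ → Type*) [∀ n, NormedAddCommGroup (G n)] [∀ n, NormedSpace ℂ (G n)] :
    lp (fun n => G (n + 1)) 2 →L[ℂ] lp G 2 :=
  LinearMap.mkContinuous
    { toFun := fun ξ => ⟨fun n => Nat.casesOn n 0 (fun m => ξ m), by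
        refine memℓp_gen ((summable_nat_add_iff 1).1 ?_)
        exact (lp.memℓp ξ).summable (by norm_num)⟩
      map_add' := fun ξ ζ => by
        ext n
        cases n
        · exact (add_zero _).symm
        · rfl
      map_smul' := fun c ξ => by ext n; cases n <;> simp } 1 (fun ξ => by
    rw [one_mul]
    refine lp.norm_le_of_tsum_le (by norm_num) (norm_nonneg _) ?_
    rw [lp.norm_rpow_eq_tsum (by norm_num)]
    rw [Summable.tsum_eq_zero_add]
    · simp
    · refine (summable_nat_add_iff 1).1 ?_
      exact (lp.memℓp ξ).summable (by norm_num))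

/-- The creation operator `T_x`, with `T_x(ξ₀, ξ₁, …) = (0, x ⊗ ξ₀, x ⊗ ξ₁, …)`. -/
def creation (π : HilbertRep.{u} A) (x : E) : FockSpace E π →L[ℂ] FockSpace E π :=
  shift (fun n => (tensorPower E π n).carrier) ∘L
    lp.mapCLM (E := fun n => (tensorPower E π n).carrier)
      (F := fun n => (tensorPower E π (n + 1)).carrier) 2
      (fun n => tmulL (tensorPower E π n).rep x) (norm_nonneg x)
      (fun _ => LinearMap.mkContinuous_norm_le _ (norm_nonneg x) _)

lemma diagonal_apply (π : HilbertRep.{u} A) (a : A) (ξ : FockSpace E π) (n : ℕ) :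
    diagonal E π a ξ n = (tensorPower E π n).rep a (ξ n) := rfl

lemma creation_apply_zero (π : HilbertRep.{u} A) (x : E) (ξ : FockSpace E π) :
    creation E π x ξ 0 = 0 := rfl

lemma creation_apply_succ (π : HilbertRep.{u} A) (x : E) (ξ : FockSpace E π) (n : ℕ) :
    creation E π x ξ (n + 1) = tmul (tensorPower E π n).rep x (ξ n) := rfl

/-- The Hardy algebra `H^∞(E)`: the ultraweakly closed algebra generated by the operators `φ_∞(a)`
and `T_x`. It is realized on `ℱ(E) ⊗_π H₀`: if `π` is normal and faithful, then `T ↦ T ⊗ I` is a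
faithful normal representation of the W⋆-algebra of adjointable operators on `ℱ(E)`. -/
def hardyAlgebra (π : HilbertRep.{u} A) : Subalgebra ℂ (FockSpace E π →L[ℂ] FockSpace E π) :=
  sInf {S | Set.range (diagonal E π) ⊆ S ∧ Set.range (creation E π) ⊆ S ∧
    @IsClosed _ (ultraweak (FockSpace E π)) (S : Set (FockSpace E π →L[ℂ] FockSpace E π))}

lemma diagonal_mem (π : HilbertRep.{u} A) (a : A) : diagonal E π a ∈ hardyAlgebra E π :=
  Algebra.mem_sInf.2 fun _ hS => hS.1 ⟨a, rfl⟩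

lemma creation_mem (π : HilbertRep.{u} A) (x : E) : creation E π x ∈ hardyAlgebra E π :=
  Algebra.mem_sInf.2 fun _ hS => hS.2.1 ⟨x, rfl⟩

/-- The `w*`-topology of `H^∞(E)`. -/
@[reducible] def hardyTopology (π : HilbertRep.{u} A) : TopologicalSpace (hardyAlgebra E π) :=
  TopologicalSpace.induced Subtype.val (ultraweak (FockSpace E π))

/-- `Aut(H^∞(E))`: the completely isometric, `w*`-homeomorphic automorphisms of `H^∞(E)` that fix
`φ_∞(A)` elementwise. -/
structure HardyAut (π : HilbertRep.{u} A) where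
  toAlgEquiv : hardyAlgebra E π ≃ₐ[ℂ] hardyAlgebra E π
  completely_isometric : ∀ (n : ℕ) (X : Matrix (Fin n) (Fin n) (hardyAlgebra E π)),
    matrixNorm (X.map fun x => (toAlgEquiv x : FockSpace E π →L[ℂ] FockSpace E π))
      = matrixNorm (X.map fun x => (x : FockSpace E π →L[ℂ] FockSpace E π))
  continuous_toFun : @Continuous _ _ (hardyTopology E π) (hardyTopology E π) toAlgEquiv
  continuous_invFun : @Continuous _ _ (hardyTopology E π) (hardyTopology E π) toAlgEquiv.symm
  fix_diagonal : ∀ a : A, toAlgEquiv ⟨diagonal E π a, diagonal_mem E π a⟩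
    = ⟨diagonal E π a, diagonal_mem E π a⟩

end Fock

section Disc

variable {A : Type v} (E : Type u) {H : Type w}
  [CStarAlgebra A] [PartialOrder A] [StarOrderedRing A] [WStarAlgebra A]
  [NormedAddCommGroup E] [NormedSpace ℂ E] [CompleteSpace E] [Module Aᵐᵒᵖ E]
  [WStarCorrespondence A E]
  [NormedAddCommGroup H] [InnerProductSpace ℂ H] [CompleteSpace H]
  (σ : A →⋆ₐ[ℂ] (H →L[ℂ] H))

/-- The intertwining space `(E^σ)^*`: the operators `η*` from `E ⊗_σ H` to `H` with
`η* (φ(a) ⊗ I_H) = σ(a) η*` for all `a`. -/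
def intertwiners : Submodule ℂ (InteriorTensor E σ →L[ℂ] H) where
  carrier := {T | ∀ a, T ∘L inducedRep E σ a = σ a ∘L T}
  add_mem' hS hT a := by
    rw [ContinuousLinearMap.add_comp, ContinuousLinearMap.comp_add, hS a, hT a]
  zero_mem' a := by rw [ContinuousLinearMap.zero_comp, ContinuousLinearMap.comp_zero]
  smul_mem' c T hT a := by
    rw [ContinuousLinearMap.smul_comp, ContinuousLinearMap.comp_smul, hT a]

/-- The space `E^σ`: the operators `η` from `H` to `E ⊗_σ H` with
`η σ(a) = (φ(a) ⊗ I_H) η` for all `a`. -/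
def dualCorrespondence : Submodule ℂ (H →L[ℂ] InteriorTensor E σ) where
  carrier := {T | ∀ a, T ∘L σ a = inducedRep E σ a ∘L T}
  add_mem' hS hT a := by
    rw [ContinuousLinearMap.add_comp, ContinuousLinearMap.comp_add, hS a, hT a]
  zero_mem' a := by rw [ContinuousLinearMap.zero_comp, ContinuousLinearMap.comp_zero]
  smul_mem' c T hT a := by
    rw [ContinuousLinearMap.smul_comp, ContinuousLinearMap.comp_smul, hT a]

/-- The open unit disc `𝔻((E^σ)^*)`. -/
def disc : Set (intertwiners E σ) := {η | ‖η‖ < 1}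

/-- `Aut(𝔻((E^σ)^*))`: the biholomorphic self-maps of the disc (the values outside the disc are
irrelevant). -/
structure DiscAut where
  toFun : intertwiners E σ → intertwiners E σ
  invFun : intertwiners E σ → intertwiners E σ
  mapsTo_toFun : Set.MapsTo toFun (disc E σ) (disc E σ)
  mapsTo_invFun : Set.MapsTo invFun (disc E σ) (disc E σ)
  leftInvOn : Set.LeftInvOn invFun toFun (disc E σ)
  rightInvOn : Set.RightInvOn invFun toFun (disc E σ)
  differentiableOn_toFun : DifferentiableOn ℂ toFun (disc E σ)
  differentiableOn_invFun : DifferentiableOn ℂ invFun (disc E σ)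

variable {E}

/-- `ρ` is the representation `σ × η*` of `H^∞(E)`: the ultraweakly continuous, completely
contractive representation with `φ_∞(a) ↦ σ(a)` and `T_x ↦ η*(x ⊗ ·)`. -/
structure IsIntegratedForm (π : HilbertRep.{u} A) (η : intertwiners E σ)
    (ρ : hardyAlgebra E π →ₐ[ℂ] (H →L[ℂ] H)) : Prop where
  continuous : @Continuous _ _ (hardyTopology E π) (ultraweak H) ρ
  completely_contractive : ∀ (n : ℕ) (X : Matrix (Fin n) (Fin n) (hardyAlgebra E π)),
    matrixNorm (X.map ρ) ≤ matrixNorm (X.map fun x => (x : FockSpace E π →L[ℂ] FockSpace E π))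
  map_diagonal : ∀ a : A, ρ ⟨diagonal E π a, diagonal_mem E π a⟩ = σ a
  map_creation : ∀ (x : E) (h : H), ρ ⟨creation E π x, creation_mem E π x⟩ h = η.1 (tmul σ x h)

variable {σ}

/-- `g` implements `α`: the function `X̂(η*) = (σ × η*)(X)` satisfies
`(α X)^(η*) = X̂(g(η*))` for all `X` in `H^∞(E)` and all `η*` in the disc. -/
def Implements {π : HilbertRep.{u} A} (g : DiscAut E σ) (α : HardyAut E π) : Prop :=
  ∀ η ∈ disc E σ, ∀ ρ₁ ρ₂ : hardyAlgebra E π →ₐ[ℂ] (H →L[ℂ] H),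
    IsIntegratedForm σ π η ρ₁ → IsIntegratedForm σ π (g.toFun η) ρ₂ →
      ∀ X, ρ₁ (α.toAlgEquiv X) = ρ₂ X

end Disc

section Matrix

variable {A : Type v} {E : Type u} {H : Type w}
  [CStarAlgebra A] [PartialOrder A] [StarOrderedRing A] [WStarAlgebra A]
  [NormedAddCommGroup E] [NormedSpace ℂ E] [CompleteSpace E] [Module Aᵐᵒᵖ E]
  [WStarCorrespondence A E]
  [NormedAddCommGroup H] [InnerProductSpace ℂ H] [CompleteSpace H]

/-- The defect operator `Δ_γ = (I - γ*γ)^{1/2}`. With `γ*` in place of `γ` it is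
`Δ_{γ*} = (I - γγ*)^{1/2}`. -/
def defect {K L : Type*} [NormedAddCommGroup K] [InnerProductSpace ℂ K] [CompleteSpace K]
    [NormedAddCommGroup L] [InnerProductSpace ℂ L] [CompleteSpace L] (γ : K →L[ℂ] L) :
    K →L[ℂ] K :=
  CFC.sqrt (1 - ContinuousLinearMap.adjoint γ ∘L γ)

open ContinuousLinearMap (adjoint)

/-- The Möbius transformation
`g_γ(η*) = Δ_γ (I - η*γ)⁻¹ (γ* - η*) Δ_{γ*}⁻¹`. -/
def mobius {K L : Type*} [NormedAddCommGroup K] [InnerProductSpace ℂ K] [CompleteSpace K]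
    [NormedAddCommGroup L] [InnerProductSpace ℂ L] [CompleteSpace L] (γ : K →L[ℂ] L)
    (η : L →L[ℂ] K) : L →L[ℂ] K :=
  defect γ ∘L Ring.inverse (1 - η ∘L γ) ∘L (adjoint γ - η) ∘L Ring.inverse (defect (adjoint γ))

/-- A `1 × 2` block matrix `[a b]` of operators with `a : H → H` and `b : L → H`. -/
@[ext] structure Row (H L : Type*) [NormedAddCommGroup H] [NormedSpace ℂ H]
    [NormedAddCommGroup L] [NormedSpace ℂ L] where
  fst : H →L[ℂ] H
  snd : L →L[ℂ] H

/-- A `2 × 2` block matrix of operators on `H ⊕ L`. -/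
@[ext] structure BlockMatrix (H L : Type*) [NormedAddCommGroup H] [NormedSpace ℂ H]
    [NormedAddCommGroup L] [NormedSpace ℂ L] where
  a₁₁ : H →L[ℂ] H
  a₁₂ : L →L[ℂ] H
  a₂₁ : H →L[ℂ] L
  a₂₂ : L →L[ℂ] L

/-- Right multiplication of a row by a block matrix. -/
def Row.mul {H L : Type*} [NormedAddCommGroup H] [NormedSpace ℂ H]
    [NormedAddCommGroup L] [NormedSpace ℂ L] (r : Row H L) (M : BlockMatrix H L) : Row H L where
  fst := r.fst ∘L M.a₁₁ + r.snd ∘L M.a₂₁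
  snd := r.fst ∘L M.a₁₂ + r.snd ∘L M.a₂₂

/-- The block matrix with rows `Δ_γ⁻¹, γ*Δ_{γ*}⁻¹ v` and `-γΔ_γ⁻¹, -Δ_{γ*}⁻¹ v`. -/
def mobiusMatrix {K L : Type*} [NormedAddCommGroup K] [InnerProductSpace ℂ K] [CompleteSpace K]
    [NormedAddCommGroup L] [InnerProductSpace ℂ L] [CompleteSpace L] (γ : K →L[ℂ] L)
    (v : L →L[ℂ] L) : BlockMatrix K L where
  a₁₁ := Ring.inverse (defect γ)
  a₁₂ := adjoint γ ∘L Ring.inverse (defect (adjoint γ)) ∘L v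
  a₂₁ := -(γ ∘L Ring.inverse (defect γ))
  a₂₂ := -(Ring.inverse (defect (adjoint γ)) ∘L v)

/-- The commutant `σ(A)'`. -/
abbrev commutant (σ : A →⋆ₐ[ℂ] (H →L[ℂ] H)) : Subalgebra ℂ (H →L[ℂ] H) :=
  Subalgebra.centralizer ℂ (Set.range σ)

variable (E) in
/-- The pairs `(U, η*)` with `U` invertible in `σ(A)'` and `η*` in `(E^σ)^*`. -/
structure Coordinates (σ : A →⋆ₐ[ℂ] (H →L[ℂ] H)) where
  U : (commutant σ)ˣ
  η : intertwiners E σ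

/-- The pair `(U, η*)` as a row `[U η*]`. -/
def Coordinates.row {σ : A →⋆ₐ[ℂ] (H →L[ℂ] H)} (p : Coordinates E σ) :
    Row H (InteriorTensor E σ) :=
  ⟨(p.U : commutant σ), p.η⟩

/-- `(U₁, η₁*) ∼ (U₂, η₂*)` if `(C U₁, C η₁*) = (U₂, η₂*)` for an invertible `C` in `σ(A)'`. -/
instance Coordinates.setoid (σ : A →⋆ₐ[ℂ] (H →L[ℂ] H)) : Setoid (Coordinates E σ) where
  r p q := ∃ C : (commutant σ)ˣ, C * p.U = q.U ∧
    ((C : commutant σ) : H →L[ℂ] H) ∘L (p.η : InteriorTensor E σ →L[ℂ] H) = q.η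
  iseqv :=
    { refl := fun p => ⟨1, one_mul _, by ext v; rfl⟩
      symm := by
        rintro p q ⟨C, h1, h2⟩
        refine ⟨C⁻¹, by rw [← h1, inv_mul_cancel_left], ?_⟩
        have : (((C⁻¹ : (commutant σ)ˣ) : commutant σ) : H →L[ℂ] H)
            * ((C : commutant σ) : H →L[ℂ] H) = 1 := by
          exact congrArg Subtype.val C.inv_mul
        rw [← h2, ← ContinuousLinearMap.comp_assoc]
        ext v
        exact congrArg (fun f => f ((p.η : InteriorTensor E σ →L[ℂ] H) v)) this
      trans := by
        rintro p q r ⟨C, h1, h2⟩ ⟨D, h3, h4⟩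
        refine ⟨D * C, by rw [mul_assoc, h1, h3], ?_⟩
        rw [← h4, ← h2]
        ext v
        rfl }

variable (E) in
/-- The set `ℙ` of classes of pairs. -/
abbrev ProjLine (σ : A →⋆ₐ[ℂ] (H →L[ℂ] H)) : Type _ := Quotient (Coordinates.setoid (E := E) σ)

/-- The pair `(I_H, η*)`. -/
def affine {σ : A →⋆ₐ[ℂ] (H →L[ℂ] H)} (η : intertwiners E σ) : Coordinates E σ := ⟨1, η⟩

/-- The class `[U η*]` in `ℙ`. -/
abbrev Coordinates.toProj {σ : A →⋆ₐ[ℂ] (H →L[ℂ] H)} (p : Coordinates E σ) : ProjLine E σ :=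
  Quotient.mk _ p

/-- The row `r` is a pair `(U, η*)` with `U` invertible in `σ(A)'` and `η*` in `(E^σ)^*`, and its
class in `ℙ` is `P`. -/
def Row.Represents {σ : A →⋆ₐ[ℂ] (H →L[ℂ] H)} (r : Row H (InteriorTensor E σ))
    (P : ProjLine E σ) : Prop :=
  ∃ q : Coordinates E σ, q.row = r ∧ q.toProj = P

end Matrix

end Hardy

end

open Hardy

/-! The matrix `T` is the Möbius map with its denominator cleared. Multiplying out, (I η*) T = ((I -
η*γ) Δ_γ⁻¹, (γ* - η*) Δ_{γ*}⁻¹ (u ⊗ I)). Put C = (I - η*γ) Δ_γ⁻¹. Then C⁻¹ = Δ_γ (I - η*γ)⁻¹ is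
exactly the left factor in g_γ, so the second entry is C g_γ(η*)(u ⊗ I) = C g(η*), and the row is C
(I g(η*)); this is `row_mul_mobiusMatrix`.

It remains to see that C is an invertible element of σ(A)'. Invertibility comes from Neumann series,
since ‖γ‖ < 1 and ‖η*‖ < 1. As for the commutant, γ*γ and η*γ are composites of intertwiners H → E
⊗_σ H → H, hence commute with σ(A); so do the square root Δ_γ, by functional calculus, and all the
inverses. `exists_units_commutant_mobius` collects this. The entry C g(η*) lies in (E^σ)^* because g
takes its values there and σ(A)' acts on (E^σ)^* from the left.

Another representative of [I η*] is D (I η*) with D invertible in σ(A)'. Left multiplication by D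
commutes with right multiplication by `T` (`Row.comp_mul`), so its image is DC (I g(η*)), in the
same class. -/

namespace Hardy

open ContinuousLinearMap (adjoint)

/-! ### Defect operators and the factorization of the row (I η*) T -/

section Defect

variable {K L : Type*} [NormedAddCommGroup K] [InnerProductSpace ℂ K] [CompleteSpace K]
  [NormedAddCommGroup L] [InnerProductSpace ℂ L] [CompleteSpace L]

/-- The defect operator of a strict contraction is invertible. -/
lemma isUnit_defect {γ : K →L[ℂ] L} (hγ : ‖γ‖ < 1) : IsUnit (defect γ) := by
  -- By the C⋆-identity the norm is ‖γ‖², so I - γ*γ is invertible by a Neumann series.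
  have hlt : ‖adjoint γ ∘L γ‖ < 1 := by
    rw [ContinuousLinearMap.norm_adjoint_comp_self]
    nlinarith [norm_nonneg γ]
  have hnonneg : 0 ≤ adjoint γ ∘L γ :=
    (ContinuousLinearMap.nonneg_iff_isPositive _).2 γ.isPositive_adjoint_comp_self
  have hle : adjoint γ ∘L γ ≤ 1 :=
    (CStarAlgebra.norm_le_one_iff_of_nonneg _ hnonneg).1 hlt.le
  -- The square root is invertible exactly when its argument is, provided that the argument is
  -- positive; this is what `hle` supplies.
  rw [defect, CFC.isUnit_sqrt_iff _ (sub_nonneg.2 hle)]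
  exact isUnit_one_sub_of_norm_lt_one hlt

/-- An operator commuting with `γ*γ` commutes with the defect operator of `γ`. -/
lemma commute_defect {γ : K →L[ℂ] L} {T : K →L[ℂ] K} (hT : Commute (adjoint γ ∘L γ) T) :
    Commute (defect γ) T :=
  -- `CFC.sqrt` is the functional calculus of `NNReal.sqrt`, and the functional calculus preserves
  -- commutation.
  ((Commute.one_left T).sub_left hT).cfcₙ_nnreal NNReal.sqrt

/-- For a strict contraction `γ` and a contraction `η`, the operator `I - ηγ` is invertible. -/
lemma isUnit_one_sub_comp {γ : K →L[ℂ] L} {η : L →L[ℂ] K} (hγ : ‖γ‖ < 1) (hη : ‖η‖ ≤ 1) :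
    IsUnit (1 - η ∘L γ) := by
  refine isUnit_one_sub_of_norm_lt_one ((η.opNorm_comp_le γ).trans_lt ?_)
  nlinarith [norm_nonneg γ]

/-- The row `[I η] T` is `C [I g]`, where `C = (I - ηγ) Δ_γ⁻¹` and `g = g_γ(η) v`. -/
lemma row_mul_mobiusMatrix {γ : K →L[ℂ] L} {η : L →L[ℂ] K} (hγ : ‖γ‖ < 1) (hη : ‖η‖ ≤ 1)
    (v : L →L[ℂ] L) :
    (Row.mk 1 η).mul (mobiusMatrix γ v) =
      ⟨(1 - η ∘L γ) * Ring.inverse (defect γ),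
        ((1 - η ∘L γ) * Ring.inverse (defect γ)) ∘L mobius γ η ∘L v⟩ := by
  -- Only two cancellations are needed: Δ_γ⁻¹Δ_γ and (I - ηγ)(I - ηγ)⁻¹. The factor Δ_{γ*}⁻¹ stands
  -- in the same place on both sides and is never cancelled, so its invertibility plays no role.
  have hΔ := Ring.inverse_mul_cancel _ (isUnit_defect hγ)
  have hU := Ring.mul_inverse_cancel _ (isUnit_one_sub_comp hγ hη)
  ext x
  · simp [Row.mul, mobiusMatrix, sub_eq_add_neg]
  -- In pointwise form the cancellations apply inside a nested composition, whatever its bracketing.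
  · have h1 : ∀ y, Ring.inverse (defect γ) (defect γ y) = y := fun y =>
      congrArg (fun f : K →L[ℂ] K => f y) hΔ
    have h2 : ∀ y, (1 - η ∘L γ) (Ring.inverse (1 - η ∘L γ) y) = y := fun y =>
      congrArg (fun f : K →L[ℂ] K => f y) hU
    simp only [Row.mul, mobiusMatrix, mobius, ContinuousLinearMap.comp_apply,
      mul_apply_eq_comp, h1, h2]
    simp [sub_eq_add_neg]

/-- Associativity D(rM) = (Dr)M: this is what makes the action of a matrix compatible with the
scaling relation that defines `ProjLine`. -/
lemma Row.comp_mul (D : K →L[ℂ] K) (r : Row K L) (M : BlockMatrix K L) :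
    (Row.mk (D ∘L r.fst) (D ∘L r.snd)).mul M =
      ⟨D ∘L (r.mul M).fst, D ∘L (r.mul M).snd⟩ := by
  ext x <;> simp [Row.mul]

end Defect

/-! ### Membership in the commutant and in the intertwining space -/

section Commutant

variable {A : Type v} {E : Type u} {H : Type w}
  [CStarAlgebra A] [PartialOrder A] [StarOrderedRing A] [WStarAlgebra A]
  [NormedAddCommGroup E] [NormedSpace ℂ E] [CompleteSpace E] [Module Aᵐᵒᵖ E]
  [WStarCorrespondence A E]
  [NormedAddCommGroup H] [InnerProductSpace ℂ H] [CompleteSpace H]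
  {σ : A →⋆ₐ[ℂ] (H →L[ℂ] H)}

lemma mem_commutant_iff {T : H →L[ℂ] H} : T ∈ commutant σ ↔ ∀ a, Commute T (σ a) := by
  rw [Subalgebra.mem_centralizer_iff, Set.forall_mem_range]
  exact forall_congr' fun a => eq_comm

/-- The adjoint of an element of `E^σ` lies in `(E^σ)^*`. -/
lemma adjoint_mem_intertwiners (γ : dualCorrespondence E σ) :
    adjoint (γ : H →L[ℂ] InteriorTensor E σ) ∈ intertwiners E σ := fun a => by
  -- The relation is taken at `star a` so that passing to adjoints returns it at `a`.
  have h := congrArg adjoint (γ.2 (star a))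
  rw [ContinuousLinearMap.adjoint_comp, ContinuousLinearMap.adjoint_comp, map_star σ,
    map_star (inducedRep E σ), ContinuousLinearMap.star_eq_adjoint,
    ContinuousLinearMap.star_eq_adjoint, ContinuousLinearMap.adjoint_adjoint,
    ContinuousLinearMap.adjoint_adjoint] at h
  exact h.symm

/-- γ carries σ to the induced representation and η carries it back, so the composite intertwines σ
with itself. -/
lemma comp_mem_commutant {η : InteriorTensor E σ →L[ℂ] H} (hη : η ∈ intertwiners E σ)
    (γ : dualCorrespondence E σ) : η ∘L (γ : H →L[ℂ] InteriorTensor E σ) ∈ commutant σ :=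
  mem_commutant_iff.2 fun a => by
    change (η ∘L γ.1) ∘L σ a = σ a ∘L (η ∘L γ.1)
    rw [ContinuousLinearMap.comp_assoc, γ.2 a, ← ContinuousLinearMap.comp_assoc, hη a,
      ContinuousLinearMap.comp_assoc]

/-- The left action of σ(A)' on (E^σ)^*, which keeps rescaled rows among the admissible pairs. -/
lemma comp_mem_intertwiners {C : H →L[ℂ] H} (hC : C ∈ commutant σ) (η : intertwiners E σ) :
    C ∘L (η : InteriorTensor E σ →L[ℂ] H) ∈ intertwiners E σ := fun a => by
  have h : C ∘L σ a = σ a ∘L C := mem_commutant_iff.1 hC a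
  rw [ContinuousLinearMap.comp_assoc, η.2 a, ← ContinuousLinearMap.comp_assoc, h,
    ContinuousLinearMap.comp_assoc]

/-- γ*γ is the case η = γ* of `comp_mem_commutant`, and the square root inherits the commutation. -/
lemma defect_mem_commutant (γ : dualCorrespondence E σ) :
    defect (γ : H →L[ℂ] InteriorTensor E σ) ∈ commutant σ :=
  mem_commutant_iff.2 fun a => commute_defect
    (mem_commutant_iff.1 (comp_mem_commutant (adjoint_mem_intertwiners γ) γ) a)

/-- The commutant is closed under inversion. -/
lemma exists_units_commutant {C : H →L[ℂ] H} (hC : C ∈ commutant σ) (hu : IsUnit C) :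
    ∃ D : (commutant σ)ˣ, ((D : commutant σ) : H →L[ℂ] H) = C := by
  obtain ⟨c, rfl⟩ := hu
  have hinv : ((c⁻¹ : (H →L[ℂ] H)ˣ) : H →L[ℂ] H) ∈ commutant σ :=
    mem_commutant_iff.2 fun a => (mem_commutant_iff.1 hC a).units_inv_left
  exact ⟨⟨⟨c, hC⟩, ⟨_, hinv⟩, Subtype.ext c.mul_inv, Subtype.ext c.inv_mul⟩, rfl⟩

/-- The scalar C that relates the row (I η*) T to (I g(η*)). Both factors are invertible in B(H) and
lie in σ(A)', so C is invertible within σ(A)' and may serve as a witness of the relation. -/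
lemma exists_units_commutant_mobius {η : intertwiners E σ} (hη : η ∈ disc E σ)
    {γ : dualCorrespondence E σ} (hγ : ‖γ‖ < 1) :
    ∃ C : (commutant σ)ˣ, ((C : commutant σ) : H →L[ℂ] H) =
      (1 - (η : InteriorTensor E σ →L[ℂ] H) ∘L (γ : H →L[ℂ] InteriorTensor E σ)) *
        Ring.inverse (defect (γ : H →L[ℂ] InteriorTensor E σ)) := by
  obtain ⟨D, hD⟩ := exists_units_commutant (defect_mem_commutant γ) (isUnit_defect hγ)
  obtain ⟨F, hF⟩ := exists_units_commutant
    (sub_mem (one_mem _) (comp_mem_commutant η.2 γ))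
    (isUnit_one_sub_comp hγ (le_of_lt hη))
  refine ⟨F * D⁻¹, ?_⟩
  rw [← hF, ← hD]
  -- The inverse taken in B(H) agrees with the one in σ(A)': the inclusion maps units to units.
  have hD' : Ring.inverse ((D : commutant σ) : H →L[ℂ] H) =
      ((D⁻¹ : (commutant σ)ˣ) : commutant σ) :=
    Ring.inverse_unit (Units.map (commutant σ).val.toMonoidHom D)
  rw [hD']
  rfl

/-- A row of the form `C [I ξ]` with `C` invertible in the commutant represents `[I ξ]`. -/
lemma represents_affine (C : (commutant σ)ˣ) (ξ : intertwiners E σ) :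
    Row.Represents ⟨((C : commutant σ) : H →L[ℂ] H),
      ((C : commutant σ) : H →L[ℂ] H) ∘L (ξ : InteriorTensor E σ →L[ℂ] H)⟩
      (affine ξ).toProj := by
  refine ⟨⟨C, _, comp_mem_intertwiners (C : commutant σ).2 ξ⟩, rfl, Eq.symm (Quotient.sound ?_)⟩
  -- The witness `C` leads from (I, ξ) to (C, Cξ), hence the symmetry in the line above.
  exact ⟨C, mul_one C, rfl⟩

end Commutant

end Hardy

/-! ### The action of T on projective classes -/

theorem mainTheorem6 {A E : Type u} {H : Type w}
    [CStarAlgebra A] [PartialOrder A] [StarOrderedRing A] [WStarAlgebra A]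
    [NormedAddCommGroup E] [NormedSpace ℂ E] [CompleteSpace E] [Module Aᵐᵒᵖ E]
    [WStarCorrespondence A E]
    [NormedAddCommGroup H] [InnerProductSpace ℂ H] [CompleteSpace H]
    (σ : A →⋆ₐ[ℂ] (H →L[ℂ] H)) (hσ : ScottContinuous σ)
    (π : HilbertRep.{u} A) (hπ : ScottContinuous π.rep) (hπ' : Function.Injective π.rep)
    (α : HardyAut E π) (g : DiscAut E σ) (hg : Implements g α)
    (γ : dualCorrespondence E σ) (hγ : ‖γ‖ < 1) (u : UnitaryOp A E)
    (hform : ∀ η ∈ disc E σ, (g.toFun η : InteriorTensor E σ →L[ℂ] H)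
      = mobius (γ : H →L[ℂ] InteriorTensor E σ) η ∘L u.tensorId σ)
    (η : intertwiners E σ) (hη : η ∈ disc E σ) :
    ((affine η).row.mul (mobiusMatrix γ (u.tensorId σ))).Represents (affine (g.toFun η)).toProj ∧
    ∀ p : Coordinates E σ, p.toProj = (affine η).toProj →
      (p.row.mul (mobiusMatrix γ (u.tensorId σ))).Represents (affine (g.toFun η)).toProj := by
  have key : ∀ p : Coordinates E σ, p.toProj = (affine η).toProj →
      (p.row.mul (mobiusMatrix γ (u.tensorId σ))).Represents (affine (g.toFun η)).toProj := by
    intro p hp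
    -- The equality is reversed so that `D` carries (I, η*) to `p`, that is, p = D (I η*).
    obtain ⟨D, hDU, hDη⟩ := Quotient.exact hp.symm
    obtain ⟨C, hC⟩ := exists_units_commutant_mobius hη hγ
    have hrow : p.row = ⟨((D : commutant σ) : H →L[ℂ] H) ∘L 1,
        ((D : commutant σ) : H →L[ℂ] H) ∘L (η : InteriorTensor E σ →L[ℂ] H)⟩ := by
      refine Row.ext ?_ hDη.symm
      exact congrArg (fun V : (commutant σ)ˣ => ((V : commutant σ) : H →L[ℂ] H)) hDU.symm
    have hmul := row_mul_mobiusMatrix (γ := (γ : H →L[ℂ] InteriorTensor E σ))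
      (η := (η : InteriorTensor E σ →L[ℂ] H)) hγ (le_of_lt hη) (u.tensorId σ)
    -- The row becomes D·C·(I g(η*)). Through `hform` the operator g_γ(η*)(u ⊗ I) is recognized as a
    -- value of g, and this is what places it in (E^σ)^*; no intertwining property of u ⊗ I by
    -- itself enters.
    rw [hrow, Row.comp_mul _ (Row.mk 1 (η : InteriorTensor E σ →L[ℂ] H)),
      hmul, ← hform η hη, ← hC]
    exact represents_affine (D * C) (g.toFun η)
  -- The first claim is the second for the representative (I, η*) itself.
  exact ⟨key _ rfl, key⟩
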